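/- Let $\mathcal X$ be a real separable Hilbert space with its Borel $\sigma$-algebra, and let $T\in L^+(\mathcal X)$, i.e. $T$ is a bounded, self-adjoint, non-negative operator on $\mathcal X$. Let $k_T(x,y)=e^{-\frac12\|Tx-Ty\|^2}$ be the SE-$T$ kernel, $\mathcal H_{k_T}$ its reproducing kernel Hilbert space, and for Borel probability measures $P,Q$ on $\mathcal X$ let $$\mathrm{MMD}_{k_T}(P,Q)=\sup_{\|f\|_{\mathcal H_{k_T}}\le 1}\Big|\int f\,dP-\int f\,dQ\Big|.$$ For a trace class operator $K$ on $\mathcal X$ let $\det(I+K)=\prod_n(1+\lambda_n)$, where the $\lambda_n$ are the (complex) eigenvalues of $K$ repeated according to algebraic multiplicity. Let $P=N_{a,S}$ and $Q=N_{b,R}$ be non-degenerate Gaussian measures on $\mathcal X$, with means $a,b\in\mathcal X$ and injective (self-adjoint, non-negative, trace class) covariance operators $S,R$. Then $$\begin{aligned}\mathrm{MMD}_{k_T}(P,Q)^2={}&\det(I+2TST)^{-\frac12}+\det(I+2TRT)^{-\frac12}\\&-2\det\Big((I+TST)\big(I+(TRT)^{\frac12}(I+TST)^{-1}(TRT)^{\frac12}\big)\Big)^{-\frac12}\,e^{-\frac12\langle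 (I+T(S+R)T)^{-1}T(a-b),\,T(a-b)\rangle},\end{aligned}$$ where all the quantities involved are well defined: the supremum is finite, $I+TST$ and $I+T(S+R)T$ are invertible, $TRT$ has a non-negative self-adjoint square root, and the products defining the three determinants converge unconditionally. -/

import Mathlib

open MeasureTheory ProbabilityTheory
open scoped RealInnerProductSpace TensorProduct

noncomputable section

/-! ### Gaussian measures -/

/-- `P` is the Gaussian measure `N_{m,C}` on the Hilbert space `X` with mean `m` and (centred)
covariance operator `C`. That `C` is self-adjoint, non-negative and trace class is automatic for
the covariance operator of a Gaussian measure, so it is not listed as a field. (The centred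
covariance form is used; Mathlib's `covarianceOperator` is the uncentred one.) -/
structure IsGaussianMeasure {X : Type*} [NormedAddCommGroup X] [InnerProductSpace ℝ X]
    [CompleteSpace X] [MeasurableSpace X] [BorelSpace X]
    (m : X) (C : X →L[ℝ] X) (P : Measure X) : Prop where
  isGaussian : IsGaussian P
  mean_eq : ∫ x, x ∂P = m
  cov_eq : ∀ x y : X, covarianceBilin P x y = ⟪C x, y⟫

/-- `P` is the non-degenerate Gaussian measure `N_{m,C}`: its covariance operator is injective. -/
structure IsNondegenerateGaussianMeasure {X : Type*} [NormedAddCommGroup X]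
    [InnerProductSpace ℝ X] [CompleteSpace X] [MeasurableSpace X] [BorelSpace X]
    (m : X) (C : X →L[ℝ] X) (P : Measure X) : Prop extends IsGaussianMeasure m C P where
  injective : Function.Injective C

/-! ### Operators: determinants and square roots -/

/-- The algebraic multiplicity of `z : ℂ` as an eigenvalue of (the complexification of) a bounded
operator on a real Hilbert space; it is `0` if `z` is not an eigenvalue. -/
def algMultiplicity {X : Type*} [NormedAddCommGroup X] [InnerProductSpace ℝ X]
    (K : X →L[ℝ] X) (z : ℂ) : ℕ :=
  Module.finrank ℂ
    (Module.End.maxGenEigenspace ((K : X →ₗ[ℝ] X).baseChange ℂ : Module.End ℂ (ℂ ⊗[ℝ] X)) z)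

/-- The factor `(1 + z) ^ (multiplicity of z)` that the eigenvalue `z` of `M - I` contributes to
the determinant of `M = I + (M - I)`. It is `1` if `z = 0` or if `z` is not an eigenvalue. -/
def fredholmFactor {X : Type*} [NormedAddCommGroup X] [InnerProductSpace ℝ X]
    (M : X →L[ℝ] X) (z : ℂ) : ℂ :=
  (1 + z) ^ algMultiplicity (M - 1) z

/-- The determinant of `M = I + K`, with `K` trace class: the product `∏ (1 + λₙ)` over the
eigenvalues `λₙ` of `K = M - I`, repeated according to algebraic multiplicity. The non-real
eigenvalues of an operator on a real Hilbert space come in conjugate pairs, so that the product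
is real. -/
def fredholmDet {X : Type*} [NormedAddCommGroup X] [InnerProductSpace ℝ X]
    (M : X →L[ℝ] X) : ℝ :=
  (∏' z : ℂ, fredholmFactor M z).re

open Classical in
/-- The non-negative self-adjoint square root of an operator `A` (which exists and is unique if `A`
is itself non-negative and self-adjoint; the value is `0` if there is none). -/
def posSqrt {X : Type*} [NormedAddCommGroup X] [InnerProductSpace ℝ X] (A : X →L[ℝ] X) :
    X →L[ℝ] X :=
  if h : ∃ B : X →L[ℝ] X, B.IsPositive ∧ B * B = A then h.choose else 0

/-! ### Kernels, reproducing kernel Hilbert spaces, maximum mean discrepancy -/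

/-- A real-valued function of two variables as a matrix of operators on `ℝ`, the form in which
Mathlib's `RKHS.OfKernel` takes it. -/
def kernelMatrix {X : Type*} (k : X → X → ℝ) : Matrix X X (ℝ →L[ℝ] ℝ) :=
  Matrix.of fun x y => k x y • ContinuousLinearMap.id ℝ ℝ

/-- The values `|∫ f dP - ∫ f dQ|` for `f` in the closed unit ball of the reproducing kernel
Hilbert space of the kernel `k`. -/
def mmdValues {X : Type*} [MeasurableSpace X] (k : X → X → ℝ) [Fact (kernelMatrix k).PosSemidef]
    (P Q : Measure X) : Set ℝ :=
  {r | ∃ f : RKHS.OfKernel (kernelMatrix k), ‖f‖ ≤ 1 ∧ r = |∫ x, f x ∂P - ∫ x, f x ∂Q|}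

/-- The maximum mean discrepancy
`MMD_k(P,Q) = sup_{‖f‖_{H_k} ≤ 1} |∫ f dP - ∫ f dQ|`. -/
def mmd {X : Type*} [MeasurableSpace X] (k : X → X → ℝ) [Fact (kernelMatrix k).PosSemidef]
    (P Q : Measure X) : ℝ :=
  sSup (mmdValues k P Q)

/-- The squared-exponential kernel of a map `T` into a Hilbert space (SE-`T` kernel). -/
def seKernel {X Y : Type*} [NormedAddCommGroup Y] (T : X → Y) (x y : X) : ℝ :=
  Real.exp (-(1 / 2) * ‖T x - T y‖ ^ 2)

theorem seKernel_sum_nonneg {X Y : Type*} [NormedAddCommGroup Y] [InnerProductSpace ℝ Y]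
    (T : X → Y) (s : Finset X) (w : X → ℝ) :
    0 ≤ ∑ x ∈ s, ∑ y ∈ s, w x * w y * seKernel T x y := by
  have hpow : ∀ n : ℕ, ∀ v : X → ℝ, 0 ≤ ∑ x ∈ s, ∑ y ∈ s, v x * v y * ⟪T x, T y⟫ ^ n := by
    intro n v
    have hG : ∀ n : ℕ,
        (Matrix.of fun i j : s => ⟪T i.1, T j.1⟫ ^ n : Matrix s s ℝ).PosSemidef := by
      intro n
      induction n with
      | zero =>
        have h1 := Matrix.posSemidef_vecMulVec_self_star (fun _ : s => (1 : ℝ))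
        convert h1 using 1
        ext i j
        simp [Matrix.vecMulVec]
      | succ n ih =>
        have h1 : (Matrix.gram ℝ (fun i : s => T i.1)).PosSemidef := Matrix.posSemidef_gram ℝ _
        have e : (Matrix.of fun i j : s => ⟪T i.1, T j.1⟫ ^ (n + 1) : Matrix s s ℝ) =
            Matrix.hadamard (Matrix.of fun i j : s => ⟪T i.1, T j.1⟫ ^ n)
              (Matrix.gram ℝ (fun i : s => T i.1)) := by
          ext i j
          simp [Matrix.hadamard, Matrix.gram, pow_succ]
        rw [e]
        exact ih.hadamard h1
    have h := (hG n).dotProduct_mulVec_nonneg (fun i : s => v i.1)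
    have e : ∑ x ∈ s, ∑ y ∈ s, v x * v y * ⟪T x, T y⟫ ^ n =
        ∑ i : s, ∑ j : s, v i * v j * ⟪T i.1, T j.1⟫ ^ n := by
      rw [← Finset.sum_coe_sort s]
      exact Finset.sum_congr rfl fun i _ =>
        (Finset.sum_coe_sort s (fun y => v i * v y * ⟪T i.1, T y⟫ ^ n)).symm
    rw [e]
    refine h.trans_eq ?_
    simp only [dotProduct, Matrix.mulVec, Matrix.of_apply, Finset.mul_sum, Pi.star_apply,
      star_trivial]
    refine Finset.sum_congr rfl fun i _ => Finset.sum_congr rfl fun j _ => ?_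
    ring
  have hk : ∀ x y, seKernel T x y =
      Real.exp (-(1 / 2) * ‖T x‖ ^ 2) * Real.exp (-(1 / 2) * ‖T y‖ ^ 2) * Real.exp ⟪T x, T y⟫ := by
    intro x y
    rw [seKernel, ← Real.exp_add, ← Real.exp_add, norm_sub_sq_real]
    congr 1
    ring
  set v : X → ℝ := fun x => w x * Real.exp (-(1 / 2) * ‖T x‖ ^ 2) with hv
  have hs : HasSum (fun n : ℕ => ∑ x ∈ s, ∑ y ∈ s, v x * v y * (⟪T x, T y⟫ ^ n / n.factorial))
      (∑ x ∈ s, ∑ y ∈ s, v x * v y * Real.exp ⟪T x, T y⟫) := by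
    refine hasSum_sum fun x _ => hasSum_sum fun y _ => HasSum.mul_left _ ?_
    have := NormedSpace.expSeries_div_hasSum_exp (𝔸 := ℝ) ⟪T x, T y⟫
    rwa [← Real.exp_eq_exp_ℝ] at this
  have h0 := hs.nonneg (fun n => by
    have h1 : (0 : ℝ) ≤ (∑ x ∈ s, ∑ y ∈ s, v x * v y * ⟪T x, T y⟫ ^ n) / n.factorial :=
      div_nonneg (hpow n v) (by positivity)
    simpa only [Finset.sum_div, mul_div_assoc] using h1)
  refine h0.trans_eq ?_
  refine Finset.sum_congr rfl fun x _ => Finset.sum_congr rfl fun y _ => ?_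
  rw [hk, hv]
  ring

/-- The SE-`T` kernel is a (symmetric, positive definite) kernel. -/
theorem seKernel_posSemidef {X Y : Type*} [NormedAddCommGroup Y] [InnerProductSpace ℝ Y]
    (T : X → Y) : (kernelMatrix (seKernel T)).PosSemidef := by
  refine ((RKHS.posSemidef_tfae (𝕜 := ℝ) (K := kernelMatrix (seKernel T))).out 0 2).mpr
    (And.intro ?_ fun vv => ?_)
  · ext x y
    simp [kernelMatrix, seKernel, norm_sub_rev (T x) (T y), ContinuousLinearMap.star_eq_adjoint,
      ContinuousLinearMap.adjoint_id]
  · have h := seKernel_sum_nonneg T vv.support vv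
    refine h.trans_eq ?_
    simp only [Finsupp.sum, kernelMatrix, Matrix.of_apply, RCLike.re_to_real]
    rw [Finset.sum_comm]
    refine Finset.sum_congr rfl fun x _ => Finset.sum_congr rfl fun y _ => ?_
    simp
    ring

instance seKernel_fact {X Y : Type*} [NormedAddCommGroup Y] [InnerProductSpace ℝ Y]
    (T : X → Y) : Fact (kernelMatrix (seKernel T)).PosSemidef :=
  ⟨seKernel_posSemidef T⟩

end

/-!
The maximum mean discrepancy is the distance of the mean embeddings `∫ k(x, ·) dP(x)` and
`∫ k(y, ·) dQ(y)`, so its square is `𝔼 k(x, x') + 𝔼 k(y, y') - 2 𝔼 k(x, y)` for independent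
`x, x' ∼ P` and `y, y' ∼ Q` (`isGreatest_mmdValues`, `mmd_sq_eq`). Since `T x - T y` is again
Gaussian, `𝔼 k(x, y) = 𝔼 exp (-‖T x - T y‖ ^ 2 / 2)` is an instance of the integral of
`exp (-‖z‖ ^ 2 / 2)` against some `N_{m,C}`. The covariance `C` is compact, and in a Hilbert basis
of eigenvectors the coordinates of `z` are independent, so the integral is a product of
one-dimensional ones: it is `det (1 + C) ^ (-1/2) * exp (-⟪(1 + C)⁻¹ m, m⟫ / 2)`
(`IsGaussianMeasure.integral_exp_neg_sq`). That the determinant, defined through algebraic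
multiplicities on the complexification, is the product over the eigenbasis is
`IsDiagonal.hasProd_fredholmFactor`.

With `A = T S T` and `B = T R T`, the mixed term produces `det (1 + A + B)`, whereas the formula has
`det ((1 + A) (1 + D))` with `D = B^{1/2} (1 + A)⁻¹ B^{1/2}`, an operator that is not self-adjoint.
No trace formula for non-normal operators is needed: with `G = (1 + A)^{1/2}`, it is similar
to `G (1 + D) G = 1 + A + G D G`. The remaining identities rest on
`det (1 + A + B) = det (1 + A) det (1 + G⁻¹ B G⁻¹)`, which is read off from the Gaussian integral by
computing `𝔼 exp (-‖x + y‖ ^ 2 / 2)` for independent `x ∼ N_{0,A}`, `y ∼ N_{0,B}` in two ways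
(`fredholmDet_one_add_add`). It is applied to `A, B` and to `A, G D G`; the latter is a Gaussian
covariance because polar decomposition of `B^{1/2} G⁻¹` writes `D` as `U (G⁻¹ B G⁻¹) U†`. Finally
`D = K K†` and `G⁻¹ B G⁻¹ = K† K` for `K = B^{1/2} G⁻¹`, so they have the same non-zero eigenvalues
(`fredholmDet_one_add_mul_comm`), and both determinants agree
(`multipliable_and_fredholmDet_mul`).
-/

noncomputable section

/-! ### Operators that are diagonal in a Hilbert basis -/

/-- The operator `K` is diagonal in the Hilbert basis `e`, with eigenvalues `l`. This is expressed
through coordinates: the `i`-th coordinate of `K x` is `l i` times that of `x`. -/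
def IsDiagonal {ι X : Type*} [NormedAddCommGroup X] [InnerProductSpace ℝ X]
    (e : HilbertBasis ι ℝ X) (l : ι → ℝ) (K : X →L[ℝ] X) : Prop :=
  ∀ x i, ⟪e i, K x⟫ = l i * ⟪e i, x⟫

section Diagonal

variable {ι X : Type*} [NormedAddCommGroup X] [InnerProductSpace ℝ X] {e : HilbertBasis ι ℝ X}

theorem HilbertBasis.ext_inner (e : HilbertBasis ι ℝ X) {x y : X}
    (h : ∀ i, ⟪e i, x⟫ = ⟪e i, y⟫) : x = y := by
  apply e.repr.injective
  ext i
  rw [e.repr_apply_apply, e.repr_apply_apply, h]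

theorem IsDiagonal.ext {l : ι → ℝ} {K L : X →L[ℝ] X} (hK : IsDiagonal e l K)
    (hL : IsDiagonal e l L) : K = L := by
  ext x
  exact e.ext_inner fun i => by rw [hK, hL]

theorem IsDiagonal.mul {l m : ι → ℝ} {K L : X →L[ℝ] X} (hK : IsDiagonal e l K)
    (hL : IsDiagonal e m L) : IsDiagonal e (fun i => l i * m i) (K * L) := fun x i => by
  rw [mul_apply_eq_comp, hK, hL, mul_assoc]

theorem isDiagonal_one : IsDiagonal e (fun _ => 1) (1 : X →L[ℝ] X) := fun x i => by simp

theorem IsDiagonal.one_add {l : ι → ℝ} {K : X →L[ℝ] X} (hK : IsDiagonal e l K) :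
    IsDiagonal e (fun i => 1 + l i) (1 + K) := fun x i => by
  simp [inner_add_right, hK x i, add_mul]

theorem IsDiagonal.apply_basis {l : ι → ℝ} {K : X →L[ℝ] X} (hK : IsDiagonal e l K) (i : ι) :
    K (e i) = l i • e i := by
  classical
  refine e.ext_inner fun j => ?_
  rw [hK, inner_smul_right, orthonormal_iff_ite.mp e.orthonormal]
  split_ifs with h <;> simp [h]

theorem isDiagonal_of_apply_basis {l : ι → ℝ} {K : X →L[ℝ] X} (hK : K.IsSymmetric)
    (h : ∀ i, K (e i) = l i • e i) : IsDiagonal e l K := fun x i => by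
  have := hK (e i) x
  change ⟪K (e i), x⟫ = ⟪e i, K x⟫ at this
  rw [← this, h, real_inner_smul_left]

theorem IsDiagonal.isPositive {l : ι → ℝ} {K : X →L[ℝ] X} (hK : IsDiagonal e l K)
    (hl : ∀ i, 0 ≤ l i) : K.IsPositive := by
  refine (ContinuousLinearMap.isPositive_iff K).mpr ⟨fun x y => ?_, fun x => ?_⟩
  · change ⟪K x, y⟫ = ⟪x, K y⟫
    rw [← (e.hasSum_inner_mul_inner (K x) y).tsum_eq, ← (e.hasSum_inner_mul_inner x (K y)).tsum_eq]
    congr 1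
    ext i
    rw [real_inner_comm, hK, hK, real_inner_comm x]
    ring
  · refine (e.hasSum_inner_mul_inner (K x) x).nonneg fun i => ?_
    rw [real_inner_comm, hK, mul_assoc]
    exact mul_nonneg (hl i) (mul_self_nonneg _)

/-- Every bounded family of reals is the diagonal of an operator. -/
theorem exists_isDiagonal (e : HilbertBasis ι ℝ X) {l : ι → ℝ} {M : ℝ} (hl : ∀ i, |l i| ≤ M) :
    ∃ K : X →L[ℝ] X, IsDiagonal e l K := by
  rcases isEmpty_or_nonempty ι with hι | ⟨⟨i₀⟩⟩
  · exact ⟨0, fun x i => hι.elim i⟩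
  have hM : 0 ≤ M := (abs_nonneg _).trans (hl i₀)
  have two : (0 : ℝ) < (2 : ENNReal).toReal := by simp
  have hb : ∀ (x : X) i, ‖l i * e.repr x i‖ ^ (2 : ENNReal).toReal ≤
      M ^ 2 * ‖e.repr x i‖ ^ (2 : ENNReal).toReal := fun x i => by
    simp only [ENNReal.toReal_ofNat, Real.rpow_ofNat, norm_mul, mul_pow]
    gcongr
    exact hl i
  have hs : ∀ x : X, Summable fun i => M ^ 2 * ‖e.repr x i‖ ^ (2 : ENNReal).toReal := fun x =>
    ((memℓp_gen_iff two).mp (lp.memℓp (e.repr x))).mul_left _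
  have hmem : ∀ x : X, Memℓp (fun i => l i * e.repr x i) 2 := fun x =>
    (memℓp_gen_iff two).mpr (Summable.of_nonneg_of_le (fun i => by positivity) (hb x) (hs x))
  let D : X →ₗ[ℝ] X :=
    { toFun := fun x => e.repr.symm ⟨fun i => l i * e.repr x i, hmem x⟩
      map_add' := fun x y => by
        rw [← map_add]
        congr 1
        ext i
        simp only [map_add, lp.coeFn_add, Pi.add_apply, mul_add]
      map_smul' := fun c x => by
        rw [← map_smul]
        congr 1
        ext i
        simp
        ring }
  refine ⟨D.mkContinuous M fun x => ?_, fun x i => ?_⟩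
  · change ‖e.repr.symm _‖ ≤ _
    rw [LinearIsometryEquiv.norm_map, ← e.repr.norm_map x]
    refine lp.norm_le_of_tsum_le two (by positivity) ?_
    refine ((Summable.of_nonneg_of_le (fun i => by positivity) (hb x) (hs x)).tsum_le_tsum
      (hb x) (hs x)).trans_eq ?_
    rw [tsum_mul_left, ← lp.norm_rpow_eq_tsum two]
    simp [mul_pow]
  · change ⟪e i, e.repr.symm _⟫ = _
    rw [← e.repr_apply_apply, LinearIsometryEquiv.apply_symm_apply, ← e.repr_apply_apply]

theorem IsDiagonal.abs_le {l : ι → ℝ} {K : X →L[ℝ] X} (hK : IsDiagonal e l K) (i : ι) :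
    |l i| ≤ ‖K‖ := by
  have h := K.le_opNorm (e i)
  rwa [hK.apply_basis, norm_smul, e.orthonormal.1, mul_one, mul_one] at h

/-- A diagonal operator with non-negative eigenvalues has a non-negative square root. -/
theorem IsDiagonal.exists_sqrt {l : ι → ℝ} {K : X →L[ℝ] X} (hK : IsDiagonal e l K)
    (hl : ∀ i, 0 ≤ l i) : ∃ B : X →L[ℝ] X, B.IsPositive ∧ B * B = K := by
  obtain ⟨B, hB⟩ := exists_isDiagonal e (l := fun i => √(l i)) (M := √‖K‖) fun i => by
    rw [abs_of_nonneg (Real.sqrt_nonneg _)]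
    exact Real.sqrt_le_sqrt ((le_abs_self _).trans (hK.abs_le i))
  refine ⟨B, hB.isPositive fun i => Real.sqrt_nonneg _, IsDiagonal.ext (e := e) (l := l) ?_ hK⟩
  convert hB.mul hB using 2 with i
  exact (Real.mul_self_sqrt (hl i)).symm

/-- `1 + K` is invertible if `K` is diagonal with non-negative eigenvalues. -/
theorem IsDiagonal.exists_inverse_one_add {l : ι → ℝ} {K : X →L[ℝ] X} (hK : IsDiagonal e l K)
    (hl : ∀ i, 0 ≤ l i) : ∃ J : X →L[ℝ] X, IsDiagonal e (fun i => (1 + l i)⁻¹) J ∧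
      J * (1 + K) = 1 ∧ (1 + K) * J = 1 := by
  have h1 : ∀ i, 1 + l i ≠ 0 := fun i => by linarith [hl i]
  obtain ⟨J, hJ⟩ := exists_isDiagonal e (l := fun i => (1 + l i)⁻¹) (M := 1) fun i => by
    rw [abs_of_nonneg (inv_nonneg.mpr (by linarith [hl i]))]
    exact inv_le_one_of_one_le₀ (by linarith [hl i])
  refine ⟨J, hJ, IsDiagonal.ext (e := e) (l := fun _ => 1) ?_ isDiagonal_one,
    IsDiagonal.ext (e := e) (l := fun _ => 1) ?_ isDiagonal_one⟩
  · convert hJ.mul hK.one_add using 2 with i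
    exact (inv_mul_cancel₀ (h1 i)).symm
  · convert hK.one_add.mul hJ using 2 with i
    exact (mul_inv_cancel₀ (h1 i)).symm

/-- The **spectral theorem** for compact self-adjoint operators, as a Hilbert basis of
eigenvectors. -/
theorem exists_hilbertBasis_isDiagonal.{u} {X : Type u} [NormedAddCommGroup X] [InnerProductSpace ℝ X]
    [CompleteSpace X] {K : X →L[ℝ] X} (hc : IsCompactOperator K) (hK : K.IsPositive) :
    ∃ (ι : Type u) (e : HilbertBasis ι ℝ X) (l : ι → ℝ), IsDiagonal e l K ∧ ∀ i, 0 ≤ l i := by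
  have hsym : (K : X →ₗ[ℝ] X).IsSymmetric := hK.isSymmetric
  let V : ℝ → Submodule ℝ X := fun r => Module.End.eigenspace (K : X →ₗ[ℝ] X) r
  have hVc : ∀ r, CompleteSpace (V r) := fun r => by
    have hcl : IsClosed (V r : Set X) := by
      have : (V r : Set X) = {x | K x = r • x} := by
        ext x
        exact Module.End.mem_eigenspace_iff
      rw [this]
      exact isClosed_eq K.continuous (continuous_const_smul r)
    exact hcl.completeSpace_coe
  choose w b hb using fun r => exists_hilbertBasis ℝ (V r)
  have hon : Orthonormal ℝ fun a : Σ r, w r => ((b a.1 a.2 : V a.1) : X) :=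
    hsym.orthogonalFamily_eigenspaces.orthonormal_sigma_orthonormal fun r => (b r).orthonormal
  have hbot : (Submodule.span ℝ (Set.range fun a : Σ r, w r => ((b a.1 a.2 : V a.1) : X)))ᗮ = ⊥ := by
    rw [eq_bot_iff, ← ContinuousLinearMap.orthogonalComplement_iSup_eigenspaces_eq_bot hc hsym]
    intro x hx
    rw [← Submodule.iInf_orthogonal, Submodule.mem_iInf]
    intro r
    refine (Submodule.mem_orthogonal _ _).mpr fun v hv => ?_
    have hp : (V r).orthogonalProjectionOnto x = 0 := (b r).ext_inner fun i => by
      rw [Submodule.inner_orthogonalProjectionOnto_eq_of_mem_left, inner_zero_right]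
      exact (Submodule.mem_orthogonal _ _).mp hx _ (Submodule.subset_span ⟨⟨r, i⟩, rfl⟩)
    have := Submodule.inner_orthogonalProjectionOnto_eq_of_mem_left (K := V r) ⟨v, hv⟩ x
    rw [hp, inner_zero_right] at this
    exact this.symm
  have heig : ∀ a : Σ r, w r, K ((b a.1 a.2 : V a.1) : X) = a.1 • ((b a.1 a.2 : V a.1) : X) :=
    fun a => Module.End.mem_eigenspace_iff.mp (b a.1 a.2 : V a.1).2
  have hd : IsDiagonal (HilbertBasis.mkOfOrthogonalEqBot hon hbot) (fun a => a.1) K :=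
    isDiagonal_of_apply_basis hsym fun a => by
      rw [HilbertBasis.coe_mkOfOrthogonalEqBot]
      exact heig a
  refine ⟨_, _, _, hd, fun a => ?_⟩
  have h := hK.inner_nonneg_left (HilbertBasis.mkOfOrthogonalEqBot hon hbot a)
  rwa [hd.apply_basis, real_inner_smul_left, real_inner_self_eq_norm_sq,
    (HilbertBasis.mkOfOrthogonalEqBot hon hbot).orthonormal.1, one_pow, mul_one] at h

end Diagonal

/-! ### Algebraic multiplicities and Fredholm determinants -/

section Multiplicity

theorem Module.End.rank_maxGenEigenspace_mul_le {F V : Type*} [Field F] [AddCommGroup V]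
    [Module F V] (f g : Module.End F V) {z : F} (hz : z ≠ 0) :
    Module.rank F ((g * f).maxGenEigenspace z) ≤ Module.rank F ((f * g).maxGenEigenspace z) := by
  have hcomm : ∀ (k : ℕ) (v : V), ((f * g - z • 1 : Module.End F V) ^ k) (f v) =
      f (((g * f - z • 1 : Module.End F V) ^ k) v) := by
    intro k
    induction k with
    | zero => simp
    | succ k ih =>
      intro v
      rw [pow_succ, pow_succ, Module.End.mul_apply, Module.End.mul_apply, ← ih]
      simp
  have hker : ∀ (k : ℕ) (v : V), f v = 0 →
      ((g * f - z • 1 : Module.End F V) ^ k) v = (-z) ^ k • v := by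
    intro k v hv
    induction k with
    | zero => simp
    | succ k ih =>
      rw [pow_succ', Module.End.mul_apply, ih, map_smul]
      simp [hv, pow_succ, smul_smul]
  have hmaps : ∀ v ∈ (g * f).maxGenEigenspace z, f v ∈ (f * g).maxGenEigenspace z := by
    intro v hv
    obtain ⟨k, hk⟩ := (Module.End.mem_maxGenEigenspace _ _ _).mp hv
    exact (Module.End.mem_maxGenEigenspace _ _ _).mpr ⟨k, by rw [hcomm, hk, map_zero]⟩
  refine LinearMap.rank_le_of_injective (f.restrict hmaps) ?_
  refine (injective_iff_map_eq_zero _).mpr fun v hv => ?_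
  obtain ⟨k, hk⟩ := (Module.End.mem_maxGenEigenspace _ _ _).mp v.2
  have hfv : f v = 0 := congrArg Subtype.val hv
  rw [hker k v hfv] at hk
  exact Subtype.ext ((smul_eq_zero.mp hk).resolve_left (pow_ne_zero _ (neg_ne_zero.mpr hz)))

variable {X : Type*} [NormedAddCommGroup X] [InnerProductSpace ℝ X]

/-- The products `K * L` and `L * K` have the same non-zero eigenvalues, with the same algebraic
multiplicities. -/
theorem algMultiplicity_mul_comm (K L : X →L[ℝ] X) {z : ℂ} (hz : z ≠ 0) :
    algMultiplicity (K * L) z = algMultiplicity (L * K) z := by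
  have h : ∀ K L : X →L[ℝ] X, (((K * L : X →L[ℝ] X) : X →ₗ[ℝ] X).baseChange ℂ :
      Module.End ℂ (ℂ ⊗[ℝ] X)) =
      ((K : X →ₗ[ℝ] X).baseChange ℂ : Module.End ℂ (ℂ ⊗[ℝ] X)) *
        ((L : X →ₗ[ℝ] X).baseChange ℂ : Module.End ℂ (ℂ ⊗[ℝ] X)) := fun K L =>
    LinearMap.baseChange_comp (A := ℂ) (L : X →ₗ[ℝ] X) (K : X →ₗ[ℝ] X)
  unfold algMultiplicity Module.finrank
  rw [h, h]
  exact congrArg _ (le_antisymm (Module.End.rank_maxGenEigenspace_mul_le _ _ hz)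
    (Module.End.rank_maxGenEigenspace_mul_le _ _ hz))

theorem fredholmFactor_eq_of_mul {M N : X →L[ℝ] X} (K L : X →L[ℝ] X) (hM : M = 1 + K * L)
    (hN : N = 1 + L * K) : fredholmFactor M = fredholmFactor N := by
  ext z
  rcases eq_or_ne z 0 with rfl | hz
  · simp [fredholmFactor]
  · rw [fredholmFactor, fredholmFactor, hM, hN, add_sub_cancel_left, add_sub_cancel_left,
      algMultiplicity_mul_comm K L hz]

/-- The Fredholm determinants of `1 + K * L` and `1 + L * K` agree. -/
theorem fredholmDet_one_add_mul_comm (K L : X →L[ℝ] X) :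
    fredholmDet (1 + K * L) = fredholmDet (1 + L * K) := by
  rw [fredholmDet, fredholmDet, fredholmFactor_eq_of_mul K L rfl rfl]

variable {ι : Type*} {e : HilbertBasis ι ℝ X} {l : ι → ℝ} {K : X →L[ℝ] X}

/-- The `i`-th coordinate with respect to the Hilbert basis `e`, extended to a complex linear
functional on the complexification. -/
def complexCoord (e : HilbertBasis ι ℝ X) (i : ι) : ℂ ⊗[ℝ] X →ₗ[ℂ] ℂ :=
  (TensorProduct.AlgebraTensorModule.rid ℝ ℂ ℂ).toLinearMap ∘ₗ
    ((innerSL ℝ (e i) : X →L[ℝ] ℝ) : X →ₗ[ℝ] ℝ).baseChange ℂ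

theorem complexCoord_tmul (i : ι) (c : ℂ) (x : X) :
    complexCoord e i (c ⊗ₜ[ℝ] x) = c * (⟪e i, x⟫ : ℝ) := by
  simp [complexCoord, mul_comm]

theorem exists_eq_tmul_add_I_tmul (v : ℂ ⊗[ℝ] X) :
    ∃ x y : X, v = (1 : ℂ) ⊗ₜ[ℝ] x + Complex.I ⊗ₜ[ℝ] y := by
  induction v using TensorProduct.induction_on with
  | zero => exact ⟨0, 0, by simp⟩
  | tmul c x =>
    refine ⟨c.re • x, c.im • x, ?_⟩
    rw [← TensorProduct.smul_tmul, ← TensorProduct.smul_tmul, ← TensorProduct.add_tmul]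
    congr 1
    apply Complex.ext <;> simp
  | add v w hv hw =>
    obtain ⟨x, y, rfl⟩ := hv
    obtain ⟨x', y', rfl⟩ := hw
    refine ⟨x + x', y + y', ?_⟩
    rw [TensorProduct.tmul_add, TensorProduct.tmul_add]
    abel

theorem eq_zero_of_complexCoord_eq_zero {v : ℂ ⊗[ℝ] X} (h : ∀ i, complexCoord e i v = 0) :
    v = 0 := by
  obtain ⟨x, y, rfl⟩ := exists_eq_tmul_add_I_tmul v
  have hxy : ∀ i, ⟪e i, x⟫ = 0 ∧ ⟪e i, y⟫ = 0 := fun i => by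
    have := h i
    rw [map_add, complexCoord_tmul, complexCoord_tmul] at this
    simpa using And.intro (congrArg Complex.re this) (congrArg Complex.im this)
  rw [e.ext_inner (x := x) (y := 0) fun i => by rw [(hxy i).1, inner_zero_right],
    e.ext_inner (x := y) (y := 0) fun i => by rw [(hxy i).2, inner_zero_right]]
  simp

theorem IsDiagonal.complexCoord_apply (hK : IsDiagonal e l K) (i : ι) (v : ℂ ⊗[ℝ] X) :
    complexCoord e i ((K : X →ₗ[ℝ] X).baseChange ℂ v) = l i * complexCoord e i v := by
  obtain ⟨x, y, rfl⟩ := exists_eq_tmul_add_I_tmul v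
  simp only [map_add, LinearMap.baseChange_tmul, complexCoord_tmul, ContinuousLinearMap.coe_coe,
    hK x i, hK y i, Complex.ofReal_mul]
  ring

theorem IsDiagonal.mem_maxGenEigenspace (hK : IsDiagonal e l K) (z : ℂ) (v : ℂ ⊗[ℝ] X) :
    v ∈ Module.End.maxGenEigenspace ((K : X →ₗ[ℝ] X).baseChange ℂ : Module.End ℂ (ℂ ⊗[ℝ] X)) z ↔
      ∀ i, (l i : ℂ) ≠ z → complexCoord e i v = 0 := by
  rw [Module.End.mem_maxGenEigenspace]
  set A : Module.End ℂ (ℂ ⊗[ℝ] X) := (K : X →ₗ[ℝ] X).baseChange ℂ with hA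
  have h : ∀ k i, complexCoord e i (((A - z • 1) ^ k) v) = (l i - z) ^ k * complexCoord e i v := by
    intro k i
    induction k with
    | zero => simp
    | succ k ih =>
      rw [pow_succ', Module.End.mul_apply, LinearMap.sub_apply, map_sub, hA,
        hK.complexCoord_apply, ← hA, LinearMap.smul_apply, Module.End.one_apply, map_smul, ih,
        smul_eq_mul]
      ring
  constructor
  · rintro ⟨k, hk⟩ i hi
    have := h k i
    rw [hk, map_zero] at this
    exact (mul_eq_zero.mp this.symm).resolve_left (pow_ne_zero _ (sub_ne_zero.mpr hi))
  · intro hv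
    refine ⟨1, eq_zero_of_complexCoord_eq_zero (e := e) fun i => ?_⟩
    rw [h]
    rcases eq_or_ne (l i : ℂ) z with hi | hi
    · simp [hi]
    · simp [hv i hi]

/-- The multiplicity of `z` as an eigenvalue of a diagonal operator is the number of diagonal
entries equal to `z`. -/
theorem IsDiagonal.algMultiplicity_eq (hK : IsDiagonal e l K) (z : ℂ)
    [Fintype {i // (l i : ℂ) = z}] :
    algMultiplicity K z = Fintype.card {i // (l i : ℂ) = z} := by
  classical
  set W := Module.End.maxGenEigenspace
    ((K : X →ₗ[ℝ] X).baseChange ℂ : Module.End ℂ (ℂ ⊗[ℝ] X)) z with hW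
  let Φ : W →ₗ[ℂ] ({i // (l i : ℂ) = z} → ℂ) :=
    LinearMap.pi fun i => complexCoord e i.1 ∘ₗ W.subtype
  have hinj : Function.Injective Φ := by
    refine (injective_iff_map_eq_zero _).mpr fun v hv => Subtype.ext ?_
    refine eq_zero_of_complexCoord_eq_zero (e := e) fun i => ?_
    by_cases hi : (l i : ℂ) = z
    · exact congrFun hv ⟨i, hi⟩
    · exact (hK.mem_maxGenEigenspace z v).mp v.2 i hi
  have hcoord : ∀ (c : {i // (l i : ℂ) = z} → ℂ) (i : ι),
      complexCoord e i (∑ j, c j ⊗ₜ[ℝ] e j.1) = ∑ j, if i = j.1 then c j else 0 := by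
    intro c i
    rw [map_sum]
    refine Finset.sum_congr rfl fun j _ => ?_
    rw [complexCoord_tmul, orthonormal_iff_ite.mp e.orthonormal]
    split_ifs <;> simp
  have hsurj : Function.Surjective Φ := by
    intro c
    refine ⟨⟨∑ j, c j ⊗ₜ[ℝ] e j.1, (hK.mem_maxGenEigenspace z _).mpr fun i hi => ?_⟩, ?_⟩
    · rw [hcoord]
      refine Finset.sum_eq_zero fun j _ => if_neg ?_
      rintro rfl
      exact hi j.2
    · ext i
      change complexCoord e i.1 (∑ j, c j ⊗ₜ[ℝ] e j.1) = _
      rw [hcoord]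
      simp [← Subtype.ext_iff]
  rw [algMultiplicity, ← hW, (LinearEquiv.ofBijective Φ ⟨hinj, hsurj⟩).finrank_eq,
    Module.finrank_fintype_fun_eq_card]

/-- The product defining the Fredholm determinant of `1 + K`, for `K` diagonal and trace class,
converges unconditionally to the product over the diagonal entries. -/
theorem IsDiagonal.hasProd_fredholmFactor (hK : IsDiagonal e l K) (hl : Summable l) :
    HasProd (fredholmFactor (1 + K)) ((∏' i, (1 + l i) : ℝ) : ℂ) := by
  have h1 : HasProd (fun i => 1 + (l i : ℂ)) ((∏' i, (1 + l i) : ℝ) : ℂ) := by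
    have := (Real.multipliable_one_add_of_summable hl).hasProd.map Complex.ofRealHom
      Complex.continuous_ofReal
    simpa [Function.comp_def] using this
  have h2 := (Equiv.sigmaFiberEquiv fun i => (l i : ℂ)).hasProd_iff.mpr h1
  refine h2.sigma fun z => ?_
  change HasProd (fun c : {i // (l i : ℂ) = z} => 1 + (l c.1 : ℂ)) _
  have h3 : (fun c : {i // (l i : ℂ) = z} => 1 + (l c.1 : ℂ)) = fun _ => 1 + z := by
    ext c
    rw [c.2]
  rw [h3]
  rcases eq_or_ne z 0 with rfl | hz
  -- infinitely many entries may vanish; they all contribute the factor `1`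
  · simp [fredholmFactor]
  have hfin : {i | (l i : ℂ) = z}.Finite := by
    have hev := (Complex.summable_ofReal.mpr hl).tendsto_cofinite_zero.eventually_ne hz.symm
    simpa using Filter.eventually_cofinite.mp hev
  have : Fintype {i // (l i : ℂ) = z} := hfin.fintype
  rw [fredholmFactor, add_sub_cancel_left, hK.algMultiplicity_eq z]
  convert hasProd_fintype (fun _ : {i // (l i : ℂ) = z} => 1 + z) using 1
  simp

theorem IsDiagonal.fredholmDet_eq (hK : IsDiagonal e l K) (hl : Summable l) :
    fredholmDet (1 + K) = ∏' i, (1 + l i) := by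
  rw [fredholmDet, (hK.hasProd_fredholmFactor hl).tprod_eq, Complex.ofReal_re]

end Multiplicity

/-! ### One-dimensional Gaussian integrals -/

theorem integral_exp_neg_sq_gaussianReal (m : ℝ) (v : NNReal) :
    ∫ x, Real.exp (-(1 / 2) * x ^ 2) ∂(gaussianReal m v) =
      (1 + v : ℝ) ^ (-(1 / 2) : ℝ) * Real.exp (-(1 / 2) * ((1 + v : ℝ)⁻¹ * m ^ 2)) := by
  rcases eq_or_ne v 0 with rfl | hv
  · simp
  have hv' : (0 : ℝ) < v := by positivity
  rw [integral_gaussianReal_eq_integral_smul hv]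
  have hw : v / (1 + v) ≠ 0 := by positivity
  -- completing the square turns the integrand into a multiple of another Gaussian density
  have key : ∀ x, gaussianPDFReal m v x • Real.exp (-(1 / 2) * x ^ 2) =
      ((1 + v : ℝ) ^ (-(1 / 2) : ℝ) * Real.exp (-(1 / 2) * ((1 + v : ℝ)⁻¹ * m ^ 2))) *
        gaussianPDFReal (m / (1 + v)) (v / (1 + v)) x := by
    intro x
    have h1 : √(2 * Real.pi * v) = √(1 + v : ℝ) * √(2 * Real.pi * (v / (1 + v) : ℝ)) := by
      rw [← Real.sqrt_mul (by positivity)]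
      congr 1
      field_simp
    have h2 : (1 + v : ℝ) ^ (-(1 / 2) : ℝ) = (√(1 + v : ℝ))⁻¹ := by
      rw [Real.rpow_neg (by positivity), Real.sqrt_eq_rpow]
    rw [gaussianPDFReal, gaussianPDFReal, h2, smul_eq_mul]
    push_cast
    rw [h1, mul_inv, mul_assoc, ← Real.exp_add, mul_mul_mul_comm, ← Real.exp_add]
    congr 2
    field_simp
    ring
  simp_rw [key]
  rw [integral_const_mul, integral_gaussianPDFReal_eq_one _ hw, mul_one]

/-! ### Gaussian measures on a separable Hilbert space -/

theorem HilbertBasis.countable {ι X : Type*} [NormedAddCommGroup X] [InnerProductSpace ℝ X]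
    [SecondCountableTopology X] (e : HilbertBasis ι ℝ X) : Countable ι := by
  refine Pairwise.countable_of_isOpen_disjoint (s := fun i => Metric.ball (e i) (1 / 2))
    (fun i j hij => Metric.ball_disjoint_ball ?_) (fun i => Metric.isOpen_ball)
    (fun i => Metric.nonempty_ball.mpr (by norm_num))
  have h : ‖e i - e j‖ ^ 2 = 2 := by
    rw [norm_sub_sq_real, e.orthonormal.1, e.orthonormal.1, e.orthonormal.2 hij]
    norm_num
  rw [dist_eq_norm]
  nlinarith [norm_nonneg (e i - e j)]

theorem one_le_tprod_one_add {ι : Type*} {l : ι → ℝ} (hl : ∀ i, 0 ≤ l i) (hs : Summable l) :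
    1 ≤ ∏' i, (1 + l i) := by
  refine ge_of_tendsto' (Real.multipliable_one_add_of_summable hs).hasProd fun s => ?_
  calc (1 : ℝ) = ∏ _i ∈ s, 1 := by simp
    _ ≤ ∏ i ∈ s, (1 + l i) :=
      Finset.prod_le_prod (fun _ _ => zero_le_one) fun i _ => by linarith [hl i]

section Gaussian

variable {X : Type*} [NormedAddCommGroup X] [InnerProductSpace ℝ X] [CompleteSpace X]
  [MeasurableSpace X] [BorelSpace X] {m a b : X} {C S R : X →L[ℝ] X} {P Q : Measure X}

theorem IsGaussianMeasure.isPositive (hP : IsGaussianMeasure m C P) : C.IsPositive := by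
  refine (ContinuousLinearMap.isPositive_iff C).mpr ⟨fun x y => ?_, fun x => ?_⟩
  · change ⟪C x, y⟫ = ⟪x, C y⟫
    rw [← hP.cov_eq, covarianceBilin_comm, hP.cov_eq, real_inner_comm]
  · rw [← hP.cov_eq]
    exact covarianceBilin_self_nonneg x

variable [SecondCountableTopology X]

theorem IsGaussianMeasure.map (hP : IsGaussianMeasure m C P) (L : X →L[ℝ] X) :
    IsGaussianMeasure (L m) (L * C * L.adjoint) (P.map L) := by
  have := hP.isGaussian
  refine ⟨inferInstance, ?_, fun x y => ?_⟩
  · rw [integral_map (by fun_prop) (by fun_prop), ← hP.mean_eq]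
    exact L.integral_comp_comm (IsGaussian.integrable_id (μ := P))
  · rw [covarianceBilin_map IsGaussian.memLp_two_id, hP.cov_eq, L.adjoint_inner_right]
    rfl

/-- The convolution of two Gaussian measures is Gaussian; means and covariances add up. -/
theorem IsGaussianMeasure.conv (hP : IsGaussianMeasure a S P) (hQ : IsGaussianMeasure b R Q) :
    IsGaussianMeasure (a + b) (S + R) (P.conv Q) := by
  have := hP.isGaussian
  have := hQ.isGaussian
  have hpos : (covarianceBilin P + covarianceBilin Q).toBilinForm.IsPosSemidef :=
    ⟨⟨fun x y => by
        simp [covarianceBilin_comm (μ := P) x y, covarianceBilin_comm (μ := Q) x y]⟩,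
      ⟨fun x => add_nonneg (covarianceBilin_self_nonneg x) (covarianceBilin_self_nonneg x)⟩⟩
  have h := gaussian_charFun_congr (μ := P.conv Q) (a + b) (covarianceBilin P + covarianceBilin Q)
    hpos fun t => by
      rw [charFun_conv, IsGaussian.charFun_eq', IsGaussian.charFun_eq', ← Complex.exp_add,
        show P[id] = a from hP.mean_eq, show Q[id] = b from hQ.mean_eq, inner_add_right]
      congr 1
      simp only [add_apply]
      push_cast
      ring
  refine ⟨inferInstance, h.1.symm, fun x y => ?_⟩
  rw [← h.2]
  simp [hP.cov_eq, hQ.cov_eq, inner_add_left]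

/-- The covariance operator is compact, being a Bochner integral of operators of rank one. -/
theorem IsGaussianMeasure.isCompactOperator (hP : IsGaussianMeasure m C P) :
    IsCompactOperator C := by
  have := hP.isGaussian
  have hL : MemLp (fun z => z - m) 2 P := IsGaussian.memLp_two_id.sub (memLp_const m)
  let F : X → X →L[ℝ] X := fun z => (innerSL ℝ (z - m)).smulRight (z - m)
  have hFc : Continuous F := by
    have h1 : Continuous fun z : X => innerSL ℝ (z - m) := by fun_prop
    exact (ContinuousLinearMap.smulRightL ℝ X X).isBoundedBilinearMap.continuous.comp
      (h1.prodMk (continuous_id.sub continuous_const))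
  have hFi : Integrable F P := by
    refine (hL.integrable_norm_pow two_ne_zero).mono' hFc.aestronglyMeasurable
      (Filter.Eventually.of_forall fun z => ?_)
    rw [ContinuousLinearMap.norm_smulRight_apply, innerSL_apply_norm, sq]
  have hFK : ∀ z, IsCompactOperator (F z) := fun z => by
    have h1 : IsCompactOperator (innerSL ℝ (z - m) : X →L[ℝ] ℝ) :=
      ⟨Metric.closedBall 0 1, isCompact_closedBall 0 1,
        (innerSL ℝ (z - m) : X →L[ℝ] ℝ).continuous.continuousAt.preimage_mem_nhds
          (by rw [map_zero]; exact Metric.closedBall_mem_nhds 0 one_pos)⟩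
    exact h1.clm_comp (ContinuousLinearMap.toSpanSingleton ℝ (z - m))
  have hC : C = ∫ z, F z ∂P := by
    ext x
    refine ext_inner_right ℝ fun y => ?_
    rw [ContinuousLinearMap.integral_apply hFi, ← hP.cov_eq,
      covarianceBilin_apply IsGaussian.memLp_two_id, real_inner_comm,
      ← integral_inner (hFi.apply_continuousLinearMap x)]
    refine integral_congr_ae (Filter.Eventually.of_forall fun z => ?_)
    simp only [F, ContinuousLinearMap.smulRight_apply, innerSL_apply_apply, inner_smul_right,
      show P[id] = m from hP.mean_eq, real_inner_comm x]
  rw [hC]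
  exact Convex.integral_mem (s := {f : X →L[ℝ] X | IsCompactOperator f})
    (compactOperator (RingHom.id ℝ) X X).convex isClosed_setOfPred_isCompactOperator
    (Filter.Eventually.of_forall hFK) hFi

/-- The diagonal entries of a covariance operator are summable: their sum is at most
`∫ ‖z - m‖ ^ 2`. -/
theorem IsGaussianMeasure.summable (hP : IsGaussianMeasure m C P) {ι : Type*}
    {e : HilbertBasis ι ℝ X} {l : ι → ℝ} (hC : IsDiagonal e l C) : Summable l := by
  have := hP.isGaussian
  have hL : MemLp (fun z => z - m) 2 P := IsGaussian.memLp_two_id.sub (memLp_const m)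
  have hl : ∀ i, l i = ∫ z, ‖⟪e i, z - m⟫‖ ^ 2 ∂P := fun i => by
    have h := hP.cov_eq (e i) (e i)
    rw [hC.apply_basis, real_inner_smul_left, real_inner_self_eq_norm_sq, e.orthonormal.1, one_pow,
      mul_one, covarianceBilin_apply IsGaussian.memLp_two_id] at h
    rw [← h, show P[id] = m from hP.mean_eq]
    simp [sq]
  have hi : ∀ i, Integrable (fun z => ‖⟪e i, z - m⟫‖ ^ 2) P := fun i =>
    (hL.const_inner (𝕜 := ℝ) (e i)).integrable_norm_pow two_ne_zero
  refine summable_of_sum_le (c := ∫ z, ‖z - m‖ ^ 2 ∂P) (fun i => ?_) fun s => ?_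
  · rw [hl]
    exact integral_nonneg fun z => by positivity
  · simp_rw [hl]
    rw [← integral_finsetSum _ fun i _ => hi i]
    exact integral_mono (integrable_finsetSum _ fun i _ => hi i)
      (hL.integrable_norm_pow two_ne_zero) fun z => e.orthonormal.sum_inner_products_le _

theorem IsGaussianMeasure.exists_isDiagonal.{u} {X : Type u} [NormedAddCommGroup X]
    [InnerProductSpace ℝ X] [CompleteSpace X] [SecondCountableTopology X] [MeasurableSpace X]
    [BorelSpace X] {m : X} {C : X →L[ℝ] X} {P : Measure X} (hP : IsGaussianMeasure m C P) :
    ∃ (ι : Type u) (e : HilbertBasis ι ℝ X) (l : ι → ℝ),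
      IsDiagonal e l C ∧ (∀ i, 0 ≤ l i) ∧ Summable l := by
  obtain ⟨ι, e, l, hC, hl⟩ := exists_hilbertBasis_isDiagonal hP.isCompactOperator hP.isPositive
  exact ⟨ι, e, l, hC, hl, hP.summable hC⟩

/-- In a Hilbert basis that diagonalizes the covariance, the coordinates are independent
Gaussians, so that the integral over finitely many of them is an explicit product. -/
theorem IsGaussianMeasure.integral_exp_neg_sum_sq (hP : IsGaussianMeasure m C P) {ι : Type*}
    {e : HilbertBasis ι ℝ X} {l : ι → ℝ} (hC : IsDiagonal e l C) (hl : ∀ i, 0 ≤ l i)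
    (s : Finset ι) :
    ∫ z, Real.exp (-(1 / 2) * ∑ i ∈ s, ⟪e i, z⟫ ^ 2) ∂P =
      (∏ i ∈ s, (1 + l i)) ^ (-(1 / 2) : ℝ) *
        Real.exp (-(1 / 2) * ∑ i ∈ s, (1 + l i)⁻¹ * ⟪e i, m⟫ ^ 2) := by
  have := hP.isGaussian
  have hcov : ∀ i j, cov[fun z => ⟪e i, z⟫, fun z => ⟪e j, z⟫; P] = l i * ⟪e i, e j⟫ := fun i j => by
    rw [← covarianceBilin_apply_eq_cov IsGaussian.memLp_two_id, hP.cov_eq, hC.apply_basis,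
      real_inner_smul_left]
  have hgauss : HasGaussianLaw (fun z (i : s) => ⟪e i.1, z⟫) P :=
    (IsGaussian.hasGaussianLaw_id (μ := P)).map
      (ContinuousLinearMap.pi fun i => innerSL ℝ (e i.1) : X →L[ℝ] (s → ℝ))
  have hind : iIndepFun (fun (i : s) z => ⟪e i.1, z⟫) P :=
    hgauss.iIndepFun_of_covariance_eq_zero fun i j hij => by
      rw [hcov, e.orthonormal.2 fun h => hij (Subtype.ext h), mul_zero]
  have hlaw : ∀ i, P.map (fun z => ⟪e i, z⟫) = gaussianReal ⟪e i, m⟫ (l i).toNNReal := fun i => by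
    have h1 : HasGaussianLaw (fun z => ⟪e i, z⟫) P :=
      (IsGaussian.hasGaussianLaw_id (μ := P)).map (innerSL ℝ (e i) : X →L[ℝ] ℝ)
    rw [h1.map_eq_gaussianReal]
    congr 1
    · rw [← hP.mean_eq]
      exact integral_inner (𝕜 := ℝ) (IsGaussian.integrable_id (μ := P)) (e i)
    · rw [← covariance_self (by fun_prop), hcov, real_inner_self_eq_norm_sq, e.orthonormal.1]
      simp
  have hone : ∀ i, ∫ z, Real.exp (-(1 / 2) * ⟪e i, z⟫ ^ 2) ∂P =
      (1 + l i) ^ (-(1 / 2) : ℝ) * Real.exp (-(1 / 2) * ((1 + l i)⁻¹ * ⟪e i, m⟫ ^ 2)) := fun i => by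
    have h := integral_map (μ := P) (φ := fun z => ⟪e i, z⟫)
      (f := fun x : ℝ => Real.exp (-(1 / 2) * x ^ 2)) (by fun_prop) (by fun_prop)
    rw [← h, hlaw, integral_exp_neg_sq_gaussianReal, Real.coe_toNNReal _ (hl i)]
  have hprod := hind.integral_fun_prod_comp (f := fun _ x => Real.exp (-(1 / 2) * x ^ 2))
    (fun i => by fun_prop) (fun i => by fun_prop)
  simp_rw [Finset.mul_sum, Real.exp_sum]
  rw [← Real.finsetProd_rpow _ _ fun i _ => by linarith [hl i], ← Finset.prod_mul_distrib,
    ← Finset.prod_coe_sort s]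
  simp_rw [← hone]
  rw [← hprod]
  refine integral_congr_ae (Filter.Eventually.of_forall fun z => ?_)
  exact (Finset.prod_coe_sort s fun i => Real.exp (-(1 / 2) * ⟪e i, z⟫ ^ 2)).symm

/-- The product over all eigenvalues is the limit of the products over finite sets of coordinates,
by dominated convergence. -/
theorem IsGaussianMeasure.integral_exp_neg_sq_of_isDiagonal (hP : IsGaussianMeasure m C P)
    {ι : Type*} {e : HilbertBasis ι ℝ X} {l : ι → ℝ} (hC : IsDiagonal e l C) (hl : ∀ i, 0 ≤ l i)
    {J : X →L[ℝ] X} (hJ : IsDiagonal e (fun i => (1 + l i)⁻¹) J) :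
    ∫ z, Real.exp (-(1 / 2) * ‖z‖ ^ 2) ∂P =
      (∏' i, (1 + l i)) ^ (-(1 / 2) : ℝ) * Real.exp (-(1 / 2) * ⟪J m, m⟫) := by
  have := hP.isGaussian
  have := e.countable
  have hsum := hP.summable hC
  have hsq : ∀ z, HasSum (fun i => ⟪e i, z⟫ ^ 2) (‖z‖ ^ 2) := fun z => by
    have h := e.hasSum_inner_mul_inner z z
    rw [real_inner_self_eq_norm_sq] at h
    simpa only [sq, real_inner_comm z] using h
  have hJm : HasSum (fun i => (1 + l i)⁻¹ * ⟪e i, m⟫ ^ 2) ⟪J m, m⟫ := by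
    have h := e.hasSum_inner_mul_inner (J m) m
    have h' : ∀ i, ⟪J m, e i⟫ = (1 + l i)⁻¹ * ⟪e i, m⟫ := fun i => by rw [real_inner_comm, hJ]
    simpa only [h', sq, mul_assoc] using h
  have hpos : 0 < ∏' i, (1 + l i) := by
    exact one_pos.trans_le (one_le_tprod_one_add hl hsum)
  have h1 : Filter.Tendsto (fun s : Finset ι =>
      ∫ z, Real.exp (-(1 / 2) * ∑ i ∈ s, ⟪e i, z⟫ ^ 2) ∂P) Filter.atTop
      (nhds (∫ z, Real.exp (-(1 / 2) * ‖z‖ ^ 2) ∂P)) := by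
    refine tendsto_integral_filter_of_dominated_convergence (fun _ => 1)
      (Filter.Eventually.of_forall fun s => by fun_prop)
      (Filter.Eventually.of_forall fun s => Filter.Eventually.of_forall fun z => ?_)
      (integrable_const _) (Filter.Eventually.of_forall fun z => ?_)
    · rw [Real.norm_eq_abs, Real.abs_exp, Real.exp_le_one_iff]
      have : 0 ≤ ∑ i ∈ s, ⟪e i, z⟫ ^ 2 := Finset.sum_nonneg fun i _ => sq_nonneg _
      linarith
    · exact (Real.continuous_exp.tendsto _).comp ((hsq z).const_mul (-(1 / 2)))
  have h2 : Filter.Tendsto (fun s : Finset ι => (∏ i ∈ s, (1 + l i)) ^ (-(1 / 2) : ℝ) *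
        Real.exp (-(1 / 2) * ∑ i ∈ s, (1 + l i)⁻¹ * ⟪e i, m⟫ ^ 2)) Filter.atTop
      (nhds ((∏' i, (1 + l i)) ^ (-(1 / 2) : ℝ) * Real.exp (-(1 / 2) * ⟪J m, m⟫))) := by
    refine Filter.Tendsto.mul ?_ ((Real.continuous_exp.tendsto _).comp (hJm.const_mul (-(1 / 2))))
    exact (Real.continuousAt_rpow_const _ _ (Or.inl hpos.ne')).tendsto.comp
      (Real.multipliable_one_add_of_summable hsum).hasProd
  refine tendsto_nhds_unique h1 ?_
  simpa only [hP.integral_exp_neg_sum_sq hC hl] using h2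

end Gaussian

/-! ### The Gaussian integral as a Fredholm determinant -/

theorem Ring.inverse_eq_of_mul_eq_one {M : Type*} [MonoidWithZero M] {x y : M} (h₁ : x * y = 1)
    (h₂ : y * x = 1) : Ring.inverse x = y :=
  Ring.inverse_unit ⟨x, y, h₁, h₂⟩

theorem Ring.inverse_mul_self_of_mul_eq_one {M : Type*} [MonoidWithZero M] {x y : M}
    (h₁ : x * y = 1) (h₂ : y * x = 1) : Ring.inverse (x * x) = y * y :=
  Ring.inverse_eq_of_mul_eq_one (by rw [mul_assoc, ← mul_assoc x y y, h₁, one_mul, h₁])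
    (by rw [mul_assoc, ← mul_assoc y x x, h₂, one_mul, h₂])

theorem integrable_exp_neg_sq {X : Type*} [NormedAddCommGroup X] [MeasurableSpace X]
    [OpensMeasurableSpace X] (μ : Measure X) [IsFiniteMeasure μ] :
    Integrable (fun x : X => Real.exp (-(1 / 2) * ‖x‖ ^ 2)) μ := by
  refine (integrable_const (1 : ℝ)).mono' (by fun_prop) (Filter.Eventually.of_forall fun x => ?_)
  rw [Real.norm_eq_abs, Real.abs_exp, Real.exp_le_one_iff]
  nlinarith [sq_nonneg ‖x‖]

section Determinant

variable {X : Type*} [NormedAddCommGroup X] [InnerProductSpace ℝ X] [CompleteSpace X]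
  [SecondCountableTopology X] [MeasurableSpace X] [BorelSpace X]
  {m : X} {A B C : X →L[ℝ] X} {P Q : Measure X}

theorem IsGaussianMeasure.isUnit_one_add (hP : IsGaussianMeasure m C P) : IsUnit (1 + C) := by
  obtain ⟨ι, e, l, hC, hl, -⟩ := hP.exists_isDiagonal
  obtain ⟨J, -, h₁, h₂⟩ := hC.exists_inverse_one_add hl
  exact ⟨⟨1 + C, J, h₂, h₁⟩, rfl⟩

theorem IsGaussianMeasure.multipliable_fredholmFactor (hP : IsGaussianMeasure m C P) :
    Multipliable (fredholmFactor (1 + C)) := by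
  obtain ⟨ι, e, l, hC, -, hs⟩ := hP.exists_isDiagonal
  exact (hC.hasProd_fredholmFactor hs).multipliable

theorem IsGaussianMeasure.fredholmDet_pos (hP : IsGaussianMeasure m C P) :
    0 < fredholmDet (1 + C) := by
  obtain ⟨ι, e, l, hC, hl, hs⟩ := hP.exists_isDiagonal
  rw [hC.fredholmDet_eq hs]
  exact one_pos.trans_le (one_le_tprod_one_add hl hs)

theorem IsGaussianMeasure.exists_sqrt (hP : IsGaussianMeasure m C P) :
    ∃ B : X →L[ℝ] X, B.IsPositive ∧ B * B = C := by
  obtain ⟨ι, e, l, hC, hl, -⟩ := hP.exists_isDiagonal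
  exact hC.exists_sqrt hl

/-- The square root of `1 + C`, together with its inverse. -/
theorem IsGaussianMeasure.exists_sqrt_one_add (hP : IsGaussianMeasure m C P) :
    ∃ G H : X →L[ℝ] X, IsSelfAdjoint G ∧ IsSelfAdjoint H ∧ G * G = 1 + C ∧ G * H = 1 ∧
      H * G = 1 := by
  obtain ⟨ι, e, l, hC, hl, -⟩ := hP.exists_isDiagonal
  have hl1 : ∀ i, 0 ≤ 1 + l i := fun i => by linarith [hl i]
  obtain ⟨J, hJ, h₁, h₂⟩ := hC.exists_inverse_one_add hl
  obtain ⟨G, hG, hGG⟩ := hC.one_add.exists_sqrt hl1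
  -- the inverse of `G` is obtained from the inverse of `G * G`
  have hr : G * (G * J) = 1 := by rw [← mul_assoc, hGG, h₂]
  have hl' : (J * G) * G = 1 := by rw [mul_assoc, hGG, h₁]
  have hinv : G * J = J * G := (left_inv_eq_right_inv hl' hr).symm
  have hGsa : IsSelfAdjoint G := hG.isSelfAdjoint
  have hJsa : IsSelfAdjoint J :=
    (hJ.isPositive fun i => inv_nonneg.mpr (hl1 i)).isSelfAdjoint
  refine ⟨G, G * J, hGsa, ?_, hGG, hr, by rw [hinv, hl']⟩
  rw [IsSelfAdjoint, star_mul, hGsa.star_eq, hJsa.star_eq, hinv]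

/-- For a Gaussian measure `N_{m,C}`, the integral of `exp (-‖z‖ ^ 2 / 2)` in closed form. -/
theorem IsGaussianMeasure.integral_exp_neg_sq (hP : IsGaussianMeasure m C P) :
    ∫ z, Real.exp (-(1 / 2) * ‖z‖ ^ 2) ∂P =
      fredholmDet (1 + C) ^ (-(1 / 2) : ℝ) *
        Real.exp (-(1 / 2) * ⟪Ring.inverse (1 + C) m, m⟫) := by
  obtain ⟨ι, e, l, hC, hl, hs⟩ := hP.exists_isDiagonal
  obtain ⟨J, hJ, h₁, h₂⟩ := hC.exists_inverse_one_add hl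
  rw [hP.integral_exp_neg_sq_of_isDiagonal hC hl hJ, hC.fredholmDet_eq hs,
    Ring.inverse_eq_of_mul_eq_one h₂ h₁]

theorem IsGaussianMeasure.const_add (hP : IsGaussianMeasure m C P) (c : X) :
    IsGaussianMeasure (c + m) C (P.map fun x => c + x) := by
  have := hP.isGaussian
  refine ⟨inferInstance, ?_, fun x y => ?_⟩
  · rw [integral_map (by fun_prop) (by fun_prop), integral_add (integrable_const c) (g := fun x => x)
      (IsGaussian.integrable_id (μ := P)), hP.mean_eq]
    simp
  · rw [covarianceBilin_map_const_add, hP.cov_eq]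

theorem IsGaussianMeasure.exists_centered (hP : IsGaussianMeasure m C P) :
    ∃ P' : Measure X, IsGaussianMeasure 0 C P' :=
  ⟨_, neg_add_cancel m ▸ hP.const_add (-m)⟩

/-! ### Multiplicativity of the determinant -/

/-- If `G = (1 + A) ^ (1/2)` then `det (1 + (A + B)) = det (1 + A) * det (1 + G⁻¹ * B * G⁻¹)`.
Both sides arise from the integral of `exp (-‖x + y‖ ^ 2 / 2)` over independent `x ∼ N_{0,A}` and
`y ∼ N_{0,B}`: directly from the law of `x + y`, and by integrating over `x` first. -/
theorem fredholmDet_one_add_add (hP : IsGaussianMeasure 0 A P) (hQ : IsGaussianMeasure 0 B Q)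
    {G H : X →L[ℝ] X} (hH : IsSelfAdjoint H) (hGG : G * G = 1 + A)
    (hGH : G * H = 1) (hHG : H * G = 1) :
    fredholmDet (1 + (A + B)) = fredholmDet (1 + A) * fredholmDet (1 + H * B * H) := by
  have := hP.isGaussian
  have := hQ.isGaussian
  have hHstar : H.adjoint = H := hH.star_eq
  have hinv : Ring.inverse (1 + A) = H * H := by
    rw [← hGG, Ring.inverse_mul_self_of_mul_eq_one hGH hHG]
  have hQH : IsGaussianMeasure 0 (H * B * H) (Q.map H) := by
    simpa [hHstar] using hQ.map H
  have hsum : IsGaussianMeasure 0 (A + B) (Q.conv P) := by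
    simpa [add_comm] using hQ.conv hP
  have hinner : ∀ y, ∫ x, Real.exp (-(1 / 2) * ‖y + x‖ ^ 2) ∂P =
      fredholmDet (1 + A) ^ (-(1 / 2) : ℝ) * Real.exp (-(1 / 2) * ‖H y‖ ^ 2) := fun y => by
    have h := (hP.const_add y).integral_exp_neg_sq
    rw [integral_map (by fun_prop) (by fun_prop), add_zero, hinv, mul_apply_eq_comp,
      ← ContinuousLinearMap.adjoint_inner_right, hHstar, real_inner_self_eq_norm_sq] at h
    exact h
  have h1 := hsum.integral_exp_neg_sq
  have h2 := hQH.integral_exp_neg_sq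
  rw [integral_conv (integrable_exp_neg_sq _)] at h1
  simp_rw [hinner] at h1
  rw [integral_map (by fun_prop) (by fun_prop)] at h2
  rw [integral_const_mul, h2] at h1
  simp only [inner_zero_right, mul_zero, Real.exp_zero, mul_one] at h1
  rw [← Real.mul_rpow hP.fredholmDet_pos.le hQH.fredholmDet_pos.le] at h1
  exact ((Real.rpow_left_inj (mul_pos hP.fredholmDet_pos hQH.fredholmDet_pos).le
    hsum.fredholmDet_pos.le (by norm_num)).mp h1).symm

/-- An operator `K` with `‖K x‖ ≤ ‖Z x‖` factors through `Z`. For `Z = (K† K) ^ (1/2)` this is the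
polar decomposition of `K`. -/
theorem exists_mul_eq_of_norm_le {X : Type*} [NormedAddCommGroup X] [InnerProductSpace ℝ X]
    [CompleteSpace X] {K Z : X →L[ℝ] X} (h : ∀ x, ‖K x‖ ≤ ‖Z x‖) : ∃ U : X →L[ℝ] X, U * Z = K := by
  let V : Submodule ℝ X := (LinearMap.range (Z : X →ₗ[ℝ] X)).topologicalClosure
  have hV : ∀ x, Z x ∈ V := fun x =>
    Submodule.le_topologicalClosure _ (LinearMap.mem_range_self (Z : X →ₗ[ℝ] X) x)
  have : CompleteSpace V := (Submodule.isClosed_topologicalClosure _).completeSpace_coe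
  let Z' : X →ₗ[ℝ] V := (Z : X →ₗ[ℝ] X).codRestrict V hV
  have hd : DenseRange Z' := by
    intro v
    rw [closure_subtype]
    have hv := v.2
    rw [← SetLike.mem_coe, Submodule.topologicalClosure_coe] at hv
    convert hv using 2
    ext x
    constructor
    · rintro ⟨-, ⟨y, rfl⟩, rfl⟩
      exact ⟨y, rfl⟩
    · rintro ⟨y, rfl⟩
      exact ⟨Z' y, ⟨y, rfl⟩, rfl⟩
  have hb : ∃ c, ∀ x, ‖(K : X →ₗ[ℝ] X) x‖ ≤ c * ‖Z' x‖ := ⟨1, fun x => by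
    rw [one_mul]
    exact h x⟩
  refine ⟨((K : X →ₗ[ℝ] X).extendOfNorm Z').comp V.orthogonalProjectionOnto, ?_⟩
  ext x
  have h1 : V.orthogonalProjectionOnto (Z x) = Z' x :=
    Submodule.orthogonalProjectionOnto_mem_subspace_eq_self (K := V) (Z' x)
  rw [mul_apply_eq_comp, ContinuousLinearMap.comp_apply, h1, LinearMap.extendOfNorm_eq hd hb]
  rfl

/-- With `W ^ 2 = B`, the determinant of `(1 + A) * (1 + W * (1 + A)⁻¹ * W)` exists and is that of
`1 + (A + B)`. The operator is not self-adjoint, but with `G = (1 + A) ^ (1/2)` and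
`D = W * (1 + A)⁻¹ * W` it is similar to `1 + (A + G * D * G)`, which has the determinant
`det (1 + A) * det (1 + D)`. -/
theorem multipliable_and_fredholmDet_mul (hP : IsGaussianMeasure 0 A P)
    (hQ : IsGaussianMeasure 0 B Q) {W : X →L[ℝ] X} (hW : W.IsPositive) (hWW : W * W = B) :
    Multipliable (fredholmFactor ((1 + A) * (1 + W * Ring.inverse (1 + A) * W))) ∧
      fredholmDet ((1 + A) * (1 + W * Ring.inverse (1 + A) * W)) = fredholmDet (1 + (A + B)) := by
  obtain ⟨G, H, hG, hH, hGG, hGH, hHG⟩ := hP.exists_sqrt_one_add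
  have hGstar : G.adjoint = G := hG.star_eq
  have hHstar : H.adjoint = H := hH.star_eq
  have hWstar : W.adjoint = W := hW.isSelfAdjoint.star_eq
  have hinv : Ring.inverse (1 + A) = H * H := by
    rw [← hGG, Ring.inverse_mul_self_of_mul_eq_one hGH hHG]
  rw [hinv]
  set D := W * (H * H) * W with hD
  have hDX : D = (W * H) * (H * W) := by simp only [hD, mul_assoc]
  have hE : H * B * H = (H * W) * (W * H) := by simp only [← hWW, mul_assoc]
  have hQH : IsGaussianMeasure 0 (H * B * H) (Q.map H) := by
    simpa [hHstar] using hQ.map H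
  obtain ⟨Z, hZ, hZZ⟩ := hQH.exists_sqrt
  have hZstar : Z.adjoint = Z := hZ.isSelfAdjoint.star_eq
  have hnorm : ∀ x, ‖(W * H) x‖ ≤ ‖Z x‖ := fun x => by
    refine (sq_le_sq₀ (norm_nonneg _) (norm_nonneg _)).mp (le_of_eq ?_)
    have hadj : (W * H).adjoint = H * W := by
      change star (W * H) = _
      rw [star_mul]
      exact congrArg₂ _ hHstar hWstar
    rw [← real_inner_self_eq_norm_sq, ← real_inner_self_eq_norm_sq,
      ← ContinuousLinearMap.adjoint_inner_right, ← ContinuousLinearMap.adjoint_inner_right, hZstar,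
      hadj, ← mul_apply_eq_comp, ← mul_apply_eq_comp, hZZ, hE]
  obtain ⟨U, hU⟩ := exists_mul_eq_of_norm_le hnorm
  have hUD : U * (H * B * H) * U.adjoint = D := by
    have h1 : star U = U.adjoint := rfl
    have h2 : Z * star U = H * W := by
      have h3 : star (U * Z) = star (W * H) := by rw [hU]
      rw [star_mul, star_mul] at h3
      rwa [show star Z = Z from hZstar, show star H = H from hHstar,
        show star W = W from hWstar] at h3
    rw [← hZZ, ← h1, ← mul_assoc, hU, mul_assoc, h2, hDX]
  have hQD : IsGaussianMeasure 0 (G * D * G) (((Q.map H).map U).map G) := by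
    have := (hQH.map U).map G
    rw [hUD, hGstar] at this
    simpa using this
  have hconv := hP.conv hQD
  have hM : (1 + A) * (1 + D) = 1 + G * ((A + G * D * G) * H) := by
    have hA : A = G * G - 1 := by rw [hGG, add_sub_cancel_left]
    have e1 : G * ((A + G * D * G) * H) = G * A * H + G * G * D * (G * H) := by noncomm_ring
    have e2 : G * A * H = A := by
      rw [hA]
      have : G * (G * G - 1) * H = G * G * (G * H) - G * H := by noncomm_ring
      rw [this, hGH, mul_one]
    rw [e1, e2, hGH, hGG]
    noncomm_ring
  have hN : 1 + (A + G * D * G) = 1 + (A + G * D * G) * H * G := by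
    rw [mul_assoc _ H G, hHG, mul_one]
  have hfac := fredholmFactor_eq_of_mul _ _ hM hN
  refine ⟨by rw [hfac]; exact hconv.multipliable_fredholmFactor, ?_⟩
  have hHD : H * (G * D * G) * H = D := by
    have : H * (G * D * G) * H = (H * G) * D * (G * H) := by noncomm_ring
    rw [this, hHG, hGH, one_mul, mul_one]
  calc fredholmDet ((1 + A) * (1 + D)) = fredholmDet (1 + (A + G * D * G)) := by
        rw [fredholmDet, fredholmDet, hfac]
    _ = fredholmDet (1 + A) * fredholmDet (1 + D) := by
        rw [fredholmDet_one_add_add hP hQD hH hGG hGH hHG, hHD]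
    _ = fredholmDet (1 + A) * fredholmDet (1 + H * B * H) := by
        rw [hDX, hE, fredholmDet_one_add_mul_comm]
    _ = fredholmDet (1 + (A + B)) := (fredholmDet_one_add_add hP hQ hH hGG hGH hHG).symm

end Determinant

/-! ### Kernel mean embeddings -/

section Embedding

variable {X Y : Type*} [NormedAddCommGroup Y] [InnerProductSpace ℝ Y]

/-- The canonical feature map of the SE-`T` kernel. -/
def seFeature (T : X → Y) (x : X) : RKHS.OfKernel (kernelMatrix (seKernel T)) :=
  RKHS.kerFun (RKHS.OfKernel (kernelMatrix (seKernel T))) x 1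

theorem inner_seFeature (T : X → Y) (x : X) (f : RKHS.OfKernel (kernelMatrix (seKernel T))) :
    ⟪seFeature T x, f⟫ = f x := by
  rw [seFeature, RKHS.kerFun_inner]
  simp

theorem inner_seFeature_seFeature (T : X → Y) (x y : X) :
    ⟪seFeature T x, seFeature T y⟫ = seKernel T x y := by
  rw [inner_seFeature, seFeature, RKHS.kerFun_apply, RKHS.OfKernel.kernel_ofKernel]
  simp [kernelMatrix]

theorem norm_seFeature (T : X → Y) (x : X) : ‖seFeature T x‖ = 1 := by
  have h := inner_seFeature_seFeature T x x
  rw [real_inner_self_eq_norm_sq] at h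
  have h1 : seKernel T x x = 1 := by simp [seKernel]
  rw [h1] at h
  exact (pow_eq_one_iff_of_nonneg (norm_nonneg _) two_ne_zero).mp h

variable [TopologicalSpace X]

theorem continuous_seFeature {T : X → Y} (hT : Continuous T) : Continuous (seFeature T) := by
  refine continuous_iff_continuousAt.mpr fun x => tendsto_iff_norm_sub_tendsto_zero.mpr ?_
  have h : ∀ y, ‖seFeature T y - seFeature T x‖ = √(2 - 2 * seKernel T y x) := fun y => by
    rw [← Real.sqrt_sq (norm_nonneg _), norm_sub_sq_real, norm_seFeature, norm_seFeature,
      inner_seFeature_seFeature]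
    congr 1
    ring
  simp_rw [h]
  have hc : Continuous fun y => √(2 - 2 * seKernel T y x) := by
    unfold seKernel
    fun_prop
  have := hc.tendsto x
  simpa [seKernel] using this

variable [SecondCountableTopology X] [MeasurableSpace X] [OpensMeasurableSpace X]

theorem integrable_seFeature {T : X → Y} (hT : Continuous T) (P : Measure X) [IsFiniteMeasure P] :
    Integrable (seFeature T) P :=
  (integrable_const (1 : ℝ)).mono' (continuous_seFeature hT).aestronglyMeasurable
    (Filter.Eventually.of_forall fun x => (norm_seFeature T x).le)

/-- The mean embedding `∫ k(x, ·) dP(x)` represents integration against `P`. -/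
theorem integral_eq_inner_integral_seFeature {T : X → Y} (hT : Continuous T) (P : Measure X)
    [IsFiniteMeasure P] (f : RKHS.OfKernel (kernelMatrix (seKernel T))) :
    ∫ x, f x ∂P = ⟪∫ x, seFeature T x ∂P, f⟫ := by
  rw [real_inner_comm, ← integral_inner (integrable_seFeature hT P)]
  exact integral_congr_ae (Filter.Eventually.of_forall fun x => by
    rw [← inner_seFeature]; exact real_inner_comm _ _)

theorem inner_integral_seFeature {T : X → Y} (hT : Continuous T) (P Q : Measure X)
    [IsFiniteMeasure P] [IsFiniteMeasure Q] :
    ⟪∫ x, seFeature T x ∂P, ∫ y, seFeature T y ∂Q⟫ = ∫ x, ∫ y, seKernel T x y ∂Q ∂P := by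
  rw [← integral_eq_inner_integral_seFeature hT]
  refine integral_congr_ae (Filter.Eventually.of_forall fun x => ?_)
  rw [← inner_seFeature, ← integral_inner (integrable_seFeature hT Q)]
  simp_rw [inner_seFeature_seFeature]

/-- The maximum mean discrepancy is attained, as the distance of the mean embeddings. -/
theorem isGreatest_mmdValues {T : X → Y} (hT : Continuous T) (P Q : Measure X)
    [IsFiniteMeasure P] [IsFiniteMeasure Q] :
    IsGreatest (mmdValues (seKernel T) P Q)
      ‖∫ x, seFeature T x ∂P - ∫ x, seFeature T x ∂Q‖ := by
  set d := ∫ x, seFeature T x ∂P - ∫ x, seFeature T x ∂Q with hd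
  have h : ∀ f : RKHS.OfKernel (kernelMatrix (seKernel T)),
      ∫ x, f x ∂P - ∫ x, f x ∂Q = ⟪d, f⟫ := fun f => by
    rw [integral_eq_inner_integral_seFeature hT, integral_eq_inner_integral_seFeature hT,
      ← inner_sub_left]
  constructor
  · refine ⟨‖d‖⁻¹ • d, ?_, ?_⟩
    · rw [norm_smul, norm_inv, norm_norm]
      exact inv_mul_le_one
    · rw [h, real_inner_smul_right, real_inner_self_eq_norm_sq, sq]
      rcases eq_or_ne ‖d‖ 0 with h0 | h0
      · simp [h0]
      · rw [inv_mul_cancel_left₀ h0, abs_norm]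
  · rintro r ⟨f, hf, rfl⟩
    rw [h]
    exact (abs_real_inner_le_norm d f).trans (mul_le_of_le_one_right (norm_nonneg d) hf)

theorem mmd_sq_eq {T : X → Y} (hT : Continuous T) (P Q : Measure X)
    [IsFiniteMeasure P] [IsFiniteMeasure Q] :
    mmd (seKernel T) P Q ^ 2 = ∫ x, ∫ y, seKernel T x y ∂P ∂P + ∫ x, ∫ y, seKernel T x y ∂Q ∂Q
      - 2 * ∫ x, ∫ y, seKernel T x y ∂Q ∂P := by
  rw [mmd, (isGreatest_mmdValues hT P Q).csSup_eq, norm_sub_sq_real, ← real_inner_self_eq_norm_sq,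
    ← real_inner_self_eq_norm_sq, inner_integral_seFeature hT, inner_integral_seFeature hT,
    inner_integral_seFeature hT]
  ring

end Embedding

/-- The expectation of the SE-`T` kernel at two independent Gaussian arguments. -/
theorem integral_integral_seKernel {X : Type*} [NormedAddCommGroup X] [InnerProductSpace ℝ X]
    [CompleteSpace X] [SecondCountableTopology X] [MeasurableSpace X] [BorelSpace X]
    {a b : X} {S R T : X →L[ℝ] X} {P Q : Measure X} (hT : IsSelfAdjoint T)
    (hP : IsGaussianMeasure a S P) (hQ : IsGaussianMeasure b R Q) :
    ∫ x, ∫ y, seKernel T x y ∂Q ∂P =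
      fredholmDet (1 + T * (S + R) * T) ^ (-(1 / 2) : ℝ) *
        Real.exp (-(1 / 2) * ⟪Ring.inverse (1 + T * (S + R) * T) (T (a - b)), T (a - b)⟫) := by
  have := hP.isGaussian
  have := hQ.isGaussian
  have hneg : IsGaussianMeasure (-b) R (Q.map (-1 : X →L[ℝ] X)) := by
    have h := hQ.map (-1)
    have hadj : (-1 : X →L[ℝ] X).adjoint = -1 := by
      change star (-1 : X →L[ℝ] X) = -1
      simp
    rw [hadj] at h
    simpa using h
  have hdiff : IsGaussianMeasure (T (a - b)) (T * (S + R) * T)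
      ((P.conv (Q.map (-1 : X →L[ℝ] X))).map T) := by
    have h := (hP.conv hneg).map T
    rwa [show T.adjoint = T from hT.star_eq, ← sub_eq_add_neg] at h
  have := hneg.isGaussian
  have hint : Integrable (fun z => Real.exp (-(1 / 2) * ‖T z‖ ^ 2))
      (P.conv (Q.map (-1 : X →L[ℝ] X))) :=
    (integrable_exp_neg_sq _).comp_measurable (f := T) (by fun_prop)
  rw [← hdiff.integral_exp_neg_sq, integral_map (by fun_prop) (by fun_prop), integral_conv hint]
  refine integral_congr_ae (Filter.Eventually.of_forall fun x => ?_)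
  simp only
  rw [integral_map (by fun_prop) (by fun_prop)]
  simp [seKernel, sub_eq_add_neg]

/-! ### The closed form of the maximum mean discrepancy -/

theorem posSqrt_spec {X : Type*} [NormedAddCommGroup X] [InnerProductSpace ℝ X] {A : X →L[ℝ] X}
    (h : ∃ B : X →L[ℝ] X, B.IsPositive ∧ B * B = A) :
    (posSqrt A).IsPositive ∧ posSqrt A * posSqrt A = A := by
  rw [posSqrt, dif_pos h]
  exact h.choose_spec

end

theorem theorem5p5 {X : Type*} [NormedAddCommGroup X] [InnerProductSpace ℝ X] [CompleteSpace X]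
    [TopologicalSpace.SeparableSpace X] [MeasurableSpace X] [BorelSpace X]
    (T S R : X →L[ℝ] X) (hT : T.IsPositive) (a b : X) (P Q : Measure X)
    (hP : IsNondegenerateGaussianMeasure a S P) (hQ : IsNondegenerateGaussianMeasure b R Q) :
    -- the objects in the formula are well defined
    BddAbove (mmdValues (seKernel T) P Q) ∧
    IsUnit (1 + T * S * T) ∧ IsUnit (1 + T * (S + R) * T) ∧
    ((posSqrt (T * R * T)).IsPositive ∧ posSqrt (T * R * T) * posSqrt (T * R * T) = T * R * T) ∧
    Multipliable (fredholmFactor (1 + (2 : ℝ) • (T * S * T))) ∧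
    Multipliable (fredholmFactor (1 + (2 : ℝ) • (T * R * T))) ∧
    Multipliable (fredholmFactor ((1 + T * S * T) *
      (1 + posSqrt (T * R * T) * Ring.inverse (1 + T * S * T) * posSqrt (T * R * T)))) ∧
    -- the formula
    mmd (seKernel T) P Q ^ 2 =
      fredholmDet (1 + (2 : ℝ) • (T * S * T)) ^ (-(1 / 2) : ℝ)
        + fredholmDet (1 + (2 : ℝ) • (T * R * T)) ^ (-(1 / 2) : ℝ)
        - 2 * fredholmDet ((1 + T * S * T) *
            (1 + posSqrt (T * R * T) * Ring.inverse (1 + T * S * T) * posSqrt (T * R * T)))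
              ^ (-(1 / 2) : ℝ)
          * Real.exp (-(1 / 2) *
              ⟪Ring.inverse (1 + T * (S + R) * T) (T (a - b)), T (a - b)⟫) := by
  have : SecondCountableTopology X := UniformSpace.secondCountable_of_separable X
  have hPG := hP.isGaussian
  have hQG := hQ.isGaussian
  have hTsa : IsSelfAdjoint T := hT.isSelfAdjoint
  have hTadj : T.adjoint = T := hTsa.star_eq
  have hTc : Continuous T := T.continuous
  have hTP : IsGaussianMeasure (T a) (T * S * T) (P.map T) := by
    simpa only [hTadj] using hP.toIsGaussianMeasure.map T
  have hTQ : IsGaussianMeasure (T b) (T * R * T) (Q.map T) := by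
    simpa only [hTadj] using hQ.toIsGaussianMeasure.map T
  obtain ⟨P', hP'⟩ := hTP.exists_centered
  obtain ⟨Q', hQ'⟩ := hTQ.exists_centered
  have hadd : ∀ S R : X →L[ℝ] X, T * (S + R) * T = T * S * T + T * R * T := fun S R => by
    rw [mul_add, add_mul]
  have hW := posSqrt_spec hTQ.exists_sqrt
  obtain ⟨hM, hdet⟩ := multipliable_and_fredholmDet_mul hP' hQ' hW.1 hW.2
  refine ⟨(isGreatest_mmdValues hTc P Q).bddAbove, hTP.isUnit_one_add, ?_, hW, ?_, ?_, hM, ?_⟩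
  · rw [hadd]
    exact (hP'.conv hQ').isUnit_one_add
  · rw [two_smul]
    exact (hP'.conv hP').multipliable_fredholmFactor
  · rw [two_smul]
    exact (hQ'.conv hQ').multipliable_fredholmFactor
  · rw [mmd_sq_eq hTc, integral_integral_seKernel hTsa hP.toIsGaussianMeasure hP.toIsGaussianMeasure,
      integral_integral_seKernel hTsa hQ.toIsGaussianMeasure hQ.toIsGaussianMeasure,
      integral_integral_seKernel hTsa hP.toIsGaussianMeasure hQ.toIsGaussianMeasure, hdet,
      hadd S S, hadd R R, hadd S R, two_smul, two_smul]
    simp only [sub_self, map_zero, inner_zero_right, mul_zero, Real.exp_zero, mul_one]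
    ring
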